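/- For each $n\in\mathbb N$ let $k(n)\le m(n)\le n$ be natural numbers and let $0\le p(n)<q(n)\le 1$. Let $G_n$ be the Erdős–Rényi graph $G(n,p(n))$ with a planted subgraph $G(m(n),q(n))$: the simple random graph on the nodes $1,\dots,n$ in which all pairs of distinct nodes are joined independently, a pair $\{i,j\}$ with probability $q(n)$ if $i,j\le m(n)$ and with probability $p(n)$ otherwise. Let $A$ be its adjacency matrix, $D$ the diagonal matrix of its degrees and $P=D^{-1}A$ (with a zero row for an isolated node). Let $\nu$ be the row vector with the entry $1/k(n)$ at the nodes $1,\dots,k(n)$ (the seeds) and $0$ elsewhere. Fix a damping factor $\alpha\in(0,1)$. The Personalized PageRank of $G_n$ is $\pi=(1-\alpha)\,\nu\,[I-\alpha P]^{-1}$. Its mean-field version is $\bar\pi=(1-\alpha)\,\nu\,[I-\alpha\bar P]^{-1}$, where $\bar P=\bar D^{-1}\bar A$, $\bar A$ is the $n\times n$ matrix with $\bar A_{ij}=q(n)$ if $i,j\le m(n)$ and $\bar A_{ij}=p(n)$ otherwise (also for $i=j$), and $\bar D$ is the diagonal matrix of the row sums of $\bar A$. Let $\eta(i)=0$ for $1\le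 i\le k(n)$, $\eta(i)=1$ for $k(n)<i\le m(n)$ and $\eta(i)=2$ for $m(n)<i\le n$. By symmetry, $\bar\pi$ is constant on each of these three classes; let $\bar\pi_0,\bar\pi_1,\bar\pi_2$ be its values there. Assume that, as $n\to\infty$, $n\,q(n)=\omega(\log n)$, $p(n)/q(n)=\Theta(1)$ and $k(n)\,p(n)=\omega(\log n)$. Let $U$ be a uniformly random node of $\{1,\dots,n\}$, independent of $G_n$. Then for every $\varepsilon>0$, $$\lim_{n\to\infty}\mathbb P\left(\left|\pi_U-\bar\pi_{\eta(U)}\right|\ge \varepsilon\, n^{-1}\right)=0 .$$ -/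

import Mathlib

open Filter Topology MeasureTheory ProbabilityTheory Asymptotics
open scoped unitInterval Matrix

namespace PlantedPPR

noncomputable section

/-- The possible edges of a simple graph on `n` nodes: the unordered pairs of distinct nodes. -/
abbrev Edge (n : ℕ) : Type := {e : Sym2 (Fin n) // ¬ e.IsDiag}

/-- The probability of the edge `e`: it is `q` if both end points lie in the community, which
consists of the first `m` nodes, and `p` otherwise. -/
def edgeProb {n : ℕ} (m : ℕ) (p q : I) (e : Edge n) : I :=
  open scoped Classical in if ∀ v ∈ e.1, v.val < m then q else p

/-- The simple graph whose edges are the pairs that are switched on in `x`. -/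
def graphOfEdges {n : ℕ} (x : Edge n → Bool) : SimpleGraph (Fin n) :=
  SimpleGraph.fromEdgeSet {e | ∃ h : ¬ e.IsDiag, x ⟨e, h⟩ = true}

/-- The law of the Erdős–Rényi graph `G(n, p)` with a planted subgraph `G(m, q)` on the first `m`
nodes: all pairs of distinct nodes are independently edges, with probabilities `edgeProb`. -/
def plantedGraph (n m : ℕ) (p q : I) : Measure (SimpleGraph (Fin n)) :=
  (Measure.pi fun e : Edge n => bernoulliMeasure true false (edgeProb m p q e)).map graphOfEdges

/-- The joint law of the planted graph and of an independent, uniformly random node. -/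
def plantedGraphWithNode (n m : ℕ) (p q : I) : Measure (SimpleGraph (Fin n) × Fin n) :=
  (plantedGraph n m p q).prod (uniformOn Set.univ)

lemma measurable_graphOfEdges {n : ℕ} :
    Measurable (graphOfEdges : (Edge n → Bool) → SimpleGraph (Fin n)) :=
  measurable_of_finite _

instance (n m : ℕ) (p q : I) : IsProbabilityMeasure (plantedGraph n m p q) :=
  Measure.isProbabilityMeasure_map measurable_graphOfEdges.aemeasurable

/-- The transition matrix `D⁻¹ W` of the random walk with weight matrix `W`, where `D` is the
diagonal matrix of the row sums of `W`. (A row of `W` with sum zero yields a zero row.) -/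
def transitionMatrix {n : ℕ} (W : Matrix (Fin n) (Fin n) ℝ) : Matrix (Fin n) (Fin n) ℝ :=
  Matrix.diagonal (fun i => (∑ j, W i j)⁻¹) * W

/-- The restart distribution: uniform on the seeds, which are the first `k` nodes. -/
def restart (n k : ℕ) : Fin n → ℝ := fun i => if i.val < k then 1 / (k : ℝ) else 0

/-- The Personalized PageRank `(1 - α) ν (I - α P)⁻¹` (a row vector) of the random walk with weight
matrix `W`, damping factor `α` and restart distribution uniform on the first `k` nodes. -/
def pprOfWeights {n : ℕ} (α : ℝ) (k : ℕ) (W : Matrix (Fin n) (Fin n) ℝ) : Fin n → ℝ :=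
  (1 - α) • (restart n k ᵥ* (1 - α • transitionMatrix W)⁻¹)

/-- The Personalized PageRank of a graph. -/
def ppr {n : ℕ} (α : ℝ) (k : ℕ) (G : SimpleGraph (Fin n)) : Fin n → ℝ :=
  open scoped Classical in pprOfWeights α k (G.adjMatrix ℝ)

/-- The mean-field adjacency matrix: `q` on the community block, `p` elsewhere. -/
def meanAdj (n m : ℕ) (p q : ℝ) : Matrix (Fin n) (Fin n) ℝ :=
  Matrix.of fun i j => if i.val < m ∧ j.val < m then q else p

/-- The mean-field Personalized PageRank. -/
def meanPPR (n m k : ℕ) (α p q : ℝ) : Fin n → ℝ :=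
  pprOfWeights α k (meanAdj n m p q)

/-- The class of a node: `0` for the seeds, `1` for the other nodes of the community, `2` for the
nodes outside the community. -/
def nodeClass {n : ℕ} (m k : ℕ) (i : Fin n) : Fin 3 :=
  if i.val < k then 0 else if i.val < m then 1 else 2

/-- The mean-field Personalized PageRank of a class: its value at any node of the class (see
`meanPPR_eq_meanClassValue`; the value for an empty class is irrelevant). -/
def meanClassValue (n m k : ℕ) (α p q : ℝ) (c : Fin 3) : ℝ :=
  open scoped Classical in
  if h : ∃ i : Fin n, nodeClass m k i = c then meanPPR n m k α p q h.choose else 0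

lemma pprOfWeights_perm {n : ℕ} (α : ℝ) (k : ℕ) (W : Matrix (Fin n) (Fin n) ℝ)
    (s : Equiv.Perm (Fin n)) (hW : W.submatrix s s = W)
    (hr : ∀ i, restart n k (s i) = restart n k i) (i : Fin n) :
    pprOfWeights α k W (s i) = pprOfWeights α k W i := by
  have hW' : ∀ a b, W (s a) (s b) = W a b := fun a b => congrFun (congrFun hW a) b
  have hT : (1 - α • transitionMatrix W).submatrix s s = 1 - α • transitionMatrix W := by
    ext a b
    have hs : ∑ j, W (s a) j = ∑ j, W a j := by
      rw [← Equiv.sum_comp s]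
      exact Finset.sum_congr rfl fun j _ => hW' a j
    simp [transitionMatrix, Matrix.diagonal_mul, Matrix.one_apply, hs, hW']
  have hinv : ∀ a b, (1 - α • transitionMatrix W)⁻¹ (s a) (s b)
      = (1 - α • transitionMatrix W)⁻¹ a b := by
    intro a b
    have h := Matrix.inv_submatrix_equiv (1 - α • transitionMatrix W) s s
    rw [hT] at h
    exact (congrFun (congrFun h a) b).symm
  simp only [pprOfWeights, Pi.smul_apply, Matrix.vecMul, dotProduct]
  congr 1
  rw [← Equiv.sum_comp s]
  exact Finset.sum_congr rfl fun j _ => by rw [hr, hinv]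

/-- The mean-field Personalized PageRank is constant on each class. -/
lemma meanPPR_eq_of_nodeClass_eq {n m k : ℕ} (hkm : k ≤ m) (α p q : ℝ) {i j : Fin n}
    (h : nodeClass m k i = nodeClass m k j) :
    meanPPR n m k α p q i = meanPPR n m k α p q j := by
  have hk : i.val < k ↔ j.val < k := by
    unfold nodeClass at h; split_ifs at h <;> omega
  have hm : i.val < m ↔ j.val < m := by
    unfold nodeClass at h; split_ifs at h <;> omega
  have key : ∀ l : ℕ, (i.val < l ↔ j.val < l) →
      ∀ a, ((Equiv.swap i j) a).val < l ↔ a.val < l := by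
    intro l hl a
    rw [Equiv.swap_apply_def]
    split_ifs with h1 h2
    · rw [h1]; exact hl.symm
    · rw [h2]; exact hl
    · rfl
  have := pprOfWeights_perm α k (meanAdj n m p q) (Equiv.swap i j)
    (by ext a b; simp [meanAdj, key m hm]) (fun a => by simp [restart, key k hk]) j
  rwa [Equiv.swap_apply_right] at this

/-- The value of a class is the mean-field Personalized PageRank of each of its nodes. -/
lemma meanPPR_eq_meanClassValue {n m k : ℕ} (hkm : k ≤ m) (α p q : ℝ) (i : Fin n) :
    meanPPR n m k α p q i = meanClassValue n m k α p q (nodeClass m k i) := by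
  have h : ∃ j : Fin n, nodeClass m k j = nodeClass m k i := ⟨i, rfl⟩
  rw [meanClassValue, dif_pos h]
  exact meanPPR_eq_of_nodeClass_eq hkm α p q h.choose_spec.symm

end

end PlantedPPR

/-!
Let `π̄` be the mean-field Personalized PageRank and `P`, `P̄` the transition matrices of the random
graph and of its mean-field version. Subtracting the fixed-point equations of `π` and `π̄` gives
`(π - π̄)(I - αP) = α π̄ (P - P̄)`, and right multiplication by `P` does not increase the `ℓ¹` norm of
a row vector. Hence `‖π - π̄‖₁ ≤ α / (1 - α) ‖π̄ (P - P̄)‖₁` (`sum_abs_pprOfWeights_sub_le`), with no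
concentration estimate on `P` itself and with a single step of the walk started from a
deterministic vector on the right.

In `π̄ (P - P̄)` the degrees are first replaced by their mean-field values, which costs the relative
fluctuation of the degrees; what remains is a sum of centred edge indicators with deterministic
weights `π̄ i / d̄ i` (`sum_abs_vecMul_transitionMatrix_sub_le`). Both are weighted degrees, whose mean
absolute deviation is bounded through their variance (`integral_abs_sum_adjMatrix_sub_le`). The bound
involves `‖π̄‖₂² ≤ max π̄ ≤ 1 / k + q / (n p)`. Altogether the expectation of `‖π - π̄‖₁`
(`integral_sum_abs_ppr_sub_meanPPR_le`) is of order `(n p)^(-1/2) + (k p)^(-1/2)` when `p` and `q` are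
comparable, which tends to `0` because `n p ≥ k p → ∞`.

The deviation at a uniformly random node has mean `‖π - π̄‖₁ / n` given the graph, so Markov's
inequality at the level `ε / n` concludes (`measureReal_prod_uniformOn_le`).
-/

namespace PlantedPPR

/-! ### Stability of Personalized PageRank in `ℓ¹` -/

lemma transitionMatrix_apply {n : ℕ} (W : Matrix (Fin n) (Fin n) ℝ) (i j : Fin n) :
    transitionMatrix W i j = (∑ l, W i l)⁻¹ * W i j := by
  simp [transitionMatrix, Matrix.diagonal_mul]

lemma sum_abs_transitionMatrix_le_one {n : ℕ} {W : Matrix (Fin n) (Fin n) ℝ}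
    (hW : ∀ i j, 0 ≤ W i j) (i : Fin n) : ∑ j, |transitionMatrix W i j| ≤ 1 := by
  have h0 : 0 ≤ ∑ l, W i l := Finset.sum_nonneg fun l _ => hW i l
  have h : ∀ j, |transitionMatrix W i j| = (∑ l, W i l)⁻¹ * W i j := fun j => by
    rw [transitionMatrix_apply, abs_of_nonneg (mul_nonneg (inv_nonneg.2 h0) (hW i j))]
  simp only [h, ← Finset.mul_sum]
  exact inv_mul_le_one

lemma sum_abs_vecMul_le {n : ℕ} {P : Matrix (Fin n) (Fin n) ℝ}
    (hP : ∀ i, ∑ j, |P i j| ≤ 1) (x : Fin n → ℝ) :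
    ∑ j, |(x ᵥ* P) j| ≤ ∑ i, |x i| := by
  calc ∑ j, |(x ᵥ* P) j| ≤ ∑ j, ∑ i, |x i| * |P i j| := by
        gcongr with j
        simp only [Matrix.vecMul, dotProduct, ← abs_mul]
        exact Finset.abs_sum_le_sum_abs _ _
    _ = ∑ i, |x i| * ∑ j, |P i j| := by
        rw [Finset.sum_comm]
        simp only [Finset.mul_sum]
    _ ≤ ∑ i, |x i| := by
        gcongr with i
        exact mul_le_of_le_one_right (abs_nonneg _) (hP i)

lemma sum_abs_le_of_eq_add_smul_vecMul {n : ℕ} {P : Matrix (Fin n) (Fin n) ℝ}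
    (hP : ∀ i, ∑ j, |P i j| ≤ 1) {α : ℝ} (hα₀ : 0 ≤ α) (hα₁ : α < 1) {x y : Fin n → ℝ}
    (h : x = y + α • (x ᵥ* P)) : ∑ i, |x i| ≤ (∑ i, |y i|) / (1 - α) := by
  rw [le_div_iff₀ (by linarith)]
  have h1 : ∑ i, |x i| ≤ ∑ i, |y i| + α * ∑ i, |(x ᵥ* P) i| := by
    rw [Finset.mul_sum, ← Finset.sum_add_distrib]
    gcongr with i
    conv_lhs => rw [h]
    refine (abs_add_le _ _).trans_eq ?_
    simp [abs_mul, abs_of_nonneg hα₀]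
  have h2 := mul_le_mul_of_nonneg_left (sum_abs_vecMul_le hP x) hα₀
  linarith

lemma isUnit_det_one_sub_smul {n : ℕ} {P : Matrix (Fin n) (Fin n) ℝ}
    (hP : ∀ i, ∑ j, |P i j| ≤ 1) {α : ℝ} (hα₀ : 0 ≤ α) (hα₁ : α < 1) :
    IsUnit (1 - α • P).det := by
  rw [isUnit_iff_ne_zero]
  intro hdet
  obtain ⟨v, hv, hv0⟩ := Matrix.exists_vecMul_eq_zero_iff.2 hdet
  refine hv ?_
  rw [Matrix.vecMul_sub, Matrix.vecMul_one, Matrix.vecMul_smul, sub_eq_zero] at hv0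
  have h := sum_abs_le_of_eq_add_smul_vecMul (y := 0) hP hα₀ hα₁ (by rwa [zero_add])
  simp only [Pi.zero_apply, abs_zero, Finset.sum_const_zero, zero_div] at h
  ext i
  have := (Finset.sum_eq_zero_iff_of_nonneg fun i _ => abs_nonneg (v i)).1
    (h.antisymm (Finset.sum_nonneg fun i _ => abs_nonneg (v i))) i (Finset.mem_univ i)
  simpa using this

/-- The fixed-point equation `π = (1 - α) ν + α π P`. -/
lemma pprOfWeights_eq {n : ℕ} {W : Matrix (Fin n) (Fin n) ℝ} (hW : ∀ i j, 0 ≤ W i j)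
    {α : ℝ} (hα₀ : 0 ≤ α) (hα₁ : α < 1) (k : ℕ) :
    pprOfWeights α k W =
      (1 - α) • restart n k + α • (pprOfWeights α k W ᵥ* transitionMatrix W) := by
  have hu := isUnit_det_one_sub_smul (sum_abs_transitionMatrix_le_one hW) hα₀ hα₁
  have h : pprOfWeights α k W ᵥ* (1 - α • transitionMatrix W) = (1 - α) • restart n k := by
    rw [pprOfWeights, Matrix.smul_vecMul, Matrix.vecMul_vecMul, Matrix.nonsing_inv_mul _ hu,
      Matrix.vecMul_one]
  rw [Matrix.vecMul_sub, Matrix.vecMul_one, Matrix.vecMul_smul] at h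
  exact sub_eq_iff_eq_add.1 h

lemma restart_nonneg (n k : ℕ) (i : Fin n) : 0 ≤ restart n k i := by
  unfold restart
  split_ifs <;> positivity

lemma restart_le (n k : ℕ) (i : Fin n) : restart n k i ≤ 1 / (k : ℝ) := by
  unfold restart
  split_ifs
  · exact le_rfl
  · positivity

lemma sum_abs_restart_le_one {n k : ℕ} (hk : k ≤ n) : ∑ i, |restart n k i| ≤ 1 := by
  have h : ∀ i, |restart n k i| = restart n k i := fun i => abs_of_nonneg (restart_nonneg n k i)
  rw [Finset.sum_congr rfl fun i _ => h i]
  unfold restart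
  rw [← Finset.sum_filter, Finset.sum_const, Fin.card_filter_val_lt, min_eq_right hk,
    nsmul_eq_mul, one_div]
  exact mul_inv_le_one

lemma sum_abs_pprOfWeights_le_one {n : ℕ} {W : Matrix (Fin n) (Fin n) ℝ} (hW : ∀ i j, 0 ≤ W i j)
    {α : ℝ} (hα₀ : 0 ≤ α) (hα₁ : α < 1) {k : ℕ} (hk : k ≤ n) :
    ∑ i, |pprOfWeights α k W i| ≤ 1 := by
  refine (sum_abs_le_of_eq_add_smul_vecMul (sum_abs_transitionMatrix_le_one hW) hα₀ hα₁
    (pprOfWeights_eq hW hα₀ hα₁ k)).trans ?_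
  rw [div_le_one (by linarith)]
  simp only [Pi.smul_apply, smul_eq_mul, abs_mul, ← Finset.mul_sum]
  rw [abs_of_pos (show 0 < 1 - α by linarith)]
  exact mul_le_of_le_one_right (by linarith) (sum_abs_restart_le_one hk)

/-- By the fixed-point equation, a node gets at most `1 / k` from the restart and at most the largest
transition probability from the walk. -/
lemma abs_pprOfWeights_le {n : ℕ} {W : Matrix (Fin n) (Fin n) ℝ} (hW : ∀ i j, 0 ≤ W i j)
    {α : ℝ} (hα₀ : 0 ≤ α) (hα₁ : α < 1) {k : ℕ} (hk : k ≤ n) {b : ℝ} (hb : 0 ≤ b)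
    (hWb : ∀ i j, |transitionMatrix W i j| ≤ b) (j : Fin n) :
    |pprOfWeights α k W j| ≤ 1 / (k : ℝ) + b := by
  have h1 : |(pprOfWeights α k W ᵥ* transitionMatrix W) j| ≤ b := by
    simp only [Matrix.vecMul, dotProduct]
    refine (Finset.abs_sum_le_sum_abs _ _).trans ?_
    calc ∑ i, |pprOfWeights α k W i * transitionMatrix W i j|
        ≤ ∑ i, |pprOfWeights α k W i| * b := by
          gcongr with i
          rw [abs_mul]
          exact mul_le_mul_of_nonneg_left (hWb i j) (abs_nonneg _)
      _ ≤ b := by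
          rw [← Finset.sum_mul]
          exact mul_le_of_le_one_left hb (sum_abs_pprOfWeights_le_one hW hα₀ hα₁ hk)
  rw [pprOfWeights_eq hW hα₀ hα₁ k]
  refine (abs_add_le _ _).trans ?_
  simp only [Pi.smul_apply, smul_eq_mul, abs_mul]
  rw [abs_of_nonneg (restart_nonneg n k j), abs_of_nonneg hα₀,
    abs_of_pos (show 0 < 1 - α by linarith)]
  exact add_le_add
    ((mul_le_of_le_one_left (restart_nonneg n k j) (by linarith)).trans (restart_le n k j))
    ((mul_le_of_le_one_left (abs_nonneg _) hα₁.le).trans h1)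

/-- Two Personalized PageRanks with the same restart distribution differ in `ℓ¹` by at most
`α / (1 - α)` times the effect on one of them of a single step with the difference of the
transition matrices. -/
lemma sum_abs_pprOfWeights_sub_le {n : ℕ} {W W' : Matrix (Fin n) (Fin n) ℝ}
    (hW : ∀ i j, 0 ≤ W i j) (hW' : ∀ i j, 0 ≤ W' i j) {α : ℝ} (hα₀ : 0 ≤ α) (hα₁ : α < 1)
    (k : ℕ) :
    ∑ j, |pprOfWeights α k W j - pprOfWeights α k W' j| ≤ α / (1 - α) *
      ∑ j, |(pprOfWeights α k W' ᵥ* (transitionMatrix W - transitionMatrix W')) j| := by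
  have h := pprOfWeights_eq hW hα₀ hα₁ k
  have h' := pprOfWeights_eq hW' hα₀ hα₁ k
  set x := pprOfWeights α k W
  set v := pprOfWeights α k W'
  have hd : x - v = α • (v ᵥ* (transitionMatrix W - transitionMatrix W')) +
      α • ((x - v) ᵥ* transitionMatrix W) := by
    rw [Matrix.vecMul_sub, Matrix.sub_vecMul]
    conv_lhs => rw [h, h']
    module
  refine (sum_abs_le_of_eq_add_smul_vecMul (sum_abs_transitionMatrix_le_one hW) hα₀ hα₁
    hd).trans_eq ?_
  simp only [Pi.smul_apply, smul_eq_mul, abs_mul, abs_of_nonneg hα₀, ← Finset.mul_sum]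
  ring

/-- The effect on `v` of one step with the difference of two transition matrices is controlled by
the fluctuations of the row sums and by those of weighted column sums. -/
lemma sum_abs_vecMul_transitionMatrix_sub_le {n : ℕ} {W W' : Matrix (Fin n) (Fin n) ℝ}
    (hW : ∀ i j, 0 ≤ W i j) (hW' : ∀ i, 0 < ∑ l, W' i l) (v : Fin n → ℝ) :
    ∑ j, |(v ᵥ* (transitionMatrix W - transitionMatrix W')) j| ≤
      ∑ i, |v i| / (∑ l, W' i l) * |∑ l, (W i l - W' i l)| +
      ∑ j, |∑ i, v i / (∑ l, W' i l) * (W i j - W' i j)| := by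
  -- Replacing the row sum of `W` by that of `W'` costs `|1 - d / d'|` in row `i`; if the row sum
  -- `d` vanishes, so does the whole row, and the cost is `0`.
  have hrow : ∀ i, ∑ j, |v i * ((∑ l, W i l)⁻¹ - (∑ l, W' i l)⁻¹) * W i j| ≤
      |v i| / (∑ l, W' i l) * |∑ l, (W i l - W' i l)| := by
    intro i
    have h' := hW' i
    have h0 : 0 ≤ ∑ l, W i l := Finset.sum_nonneg fun l _ => hW i l
    rw [Finset.sum_sub_distrib]
    simp only [abs_mul, abs_of_nonneg (hW i _), ← Finset.mul_sum]
    generalize ∑ l, W i l = d at *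
    generalize ∑ l, W' i l = d' at *
    rcases h0.eq_or_lt with rfl | hd
    · simp only [mul_zero]
      positivity
    · have : d⁻¹ - d'⁻¹ = (d' - d) / (d * d') := by field_simp
      rw [this, abs_div, abs_of_pos (mul_pos hd h'), abs_sub_comm]
      apply le_of_eq
      field_simp
  have hsplit : ∀ j, (v ᵥ* (transitionMatrix W - transitionMatrix W')) j =
      ∑ i, v i * ((∑ l, W i l)⁻¹ - (∑ l, W' i l)⁻¹) * W i j +
      ∑ i, v i / (∑ l, W' i l) * (W i j - W' i j) := by
    intro j
    simp only [Matrix.vecMul, dotProduct, Matrix.sub_apply, transitionMatrix_apply]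
    rw [← Finset.sum_add_distrib]
    refine Finset.sum_congr rfl fun i _ => ?_
    ring
  calc ∑ j, |(v ᵥ* (transitionMatrix W - transitionMatrix W')) j|
      ≤ ∑ j, (∑ i, |v i * ((∑ l, W i l)⁻¹ - (∑ l, W' i l)⁻¹) * W i j| +
          |∑ i, v i / (∑ l, W' i l) * (W i j - W' i j)|) := by
        gcongr with j
        rw [hsplit]
        exact (abs_add_le _ _).trans (by gcongr; exact Finset.abs_sum_le_sum_abs _ _)
    _ ≤ _ := by
        rw [Finset.sum_add_distrib, Finset.sum_comm]
        gcongr with i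
        exact hrow i

/-! ### Fluctuations of weighted degrees in the planted graph -/

instance {V : Type*} [Finite V] : MeasurableSingletonClass (SimpleGraph V) where
  measurableSet_singleton G := by
    have h : {G} = (SimpleGraph.edgeSet : SimpleGraph V → Set (Sym2 V)) ⁻¹' {G.edgeSet} := by
      ext H
      simp
    rw [h]
    exact SimpleGraph.measurable_edgeSet (measurableSet_singleton _)

/-- The law of the edge indicators of the planted graph. -/
noncomputable abbrev edgeLaw (n m : ℕ) (p q : I) : Measure (Edge n → Bool) :=
  Measure.pi fun e : Edge n => bernoulliMeasure true false (edgeProb m p q e)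

/-- The centred indicator of the edge `e`. -/
noncomputable def centredEdge {n : ℕ} (m : ℕ) (p q : I) (e : Edge n) (b : Bool) : ℝ :=
  (if b then 1 else 0) - (edgeProb m p q e : ℝ)

lemma edgeProb_le {n m : ℕ} {p q : I} (hpq : p ≤ q) (e : Edge n) :
    (edgeProb m p q e : ℝ) ≤ q := by
  unfold edgeProb
  split_ifs
  · exact le_rfl
  · exact hpq

lemma integral_edgeLaw_comp_eval {n m : ℕ} {p q : I} {e : Edge n} (f : Bool → ℝ) :
    ∫ x, f (x e) ∂edgeLaw n m p q = ∫ b, f b ∂bernoulliMeasure true false (edgeProb m p q e) :=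
  integral_comp_eval (μ := fun e : Edge n => bernoulliMeasure true false (edgeProb m p q e))
    (Integrable.of_finite (f := f)).aestronglyMeasurable

lemma integral_centredEdge {n m : ℕ} {p q : I} (e : Edge n) :
    ∫ x, centredEdge m p q e (x e) ∂edgeLaw n m p q = 0 := by
  rw [integral_edgeLaw_comp_eval (centredEdge m p q e), integral_bernoulliMeasure]
  simp only [centredEdge, smul_eq_mul, if_true, Bool.false_eq_true, if_false]
  ring

lemma integral_centredEdge_sq_le {n m : ℕ} {p q : I} (hpq : p ≤ q) (e : Edge n) :
    ∫ x, centredEdge m p q e (x e) ^ 2 ∂edgeLaw n m p q ≤ q := by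
  rw [integral_edgeLaw_comp_eval fun b => centredEdge m p q e b ^ 2, integral_bernoulliMeasure]
  simp only [centredEdge, smul_eq_mul, if_true, Bool.false_eq_true, if_false]
  nlinarith [edgeProb_le (m := m) hpq e, (edgeProb m p q e).2.1, sq_nonneg (edgeProb m p q e : ℝ)]

lemma memLp_of_finite {Ω : Type*} [Finite Ω] [MeasurableSpace Ω] [MeasurableSingletonClass Ω]
    {μ : Measure Ω} [IsFiniteMeasure μ] (f : Ω → ℝ) : MemLp f 2 μ :=
  (memLp_two_iff_integrable_sq Integrable.of_finite.aestronglyMeasurable).2 Integrable.of_finite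

lemma integral_abs_le_sqrt {Ω : Type*} [MeasurableSpace Ω]
    {μ : Measure Ω} [IsProbabilityMeasure μ] {f : Ω → ℝ} (hf : MemLp f 2 μ) :
    ∫ x, |f x| ∂μ ≤ √(∫ x, f x ^ 2 ∂μ) := by
  refine Real.le_sqrt_of_sq_le ?_
  have h := variance_nonneg |f| μ
  rw [variance_eq_sub hf.abs] at h
  simp only [Pi.pow_apply, Pi.abs_apply, sq_abs] at h
  linarith

/-- The edge between two distinct nodes. -/
def pairEdge {n : ℕ} (j : Fin n) (i : {i : Fin n // i ≠ j}) : Edge n :=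
  ⟨s(i.1, j), by simpa using i.2⟩

lemma pairEdge_injective {n : ℕ} (j : Fin n) : Function.Injective (pairEdge j) := by
  intro a b h
  have h' : s(a.1, j) = s(b.1, j) := congrArg Subtype.val h
  exact Subtype.ext (Sym2.congr_left.1 h')

/-- The edges at `j` are independent, so the variance of a weighted sum of them is at most `q`
times the sum of the squares of the weights. -/
lemma integral_abs_sum_centredEdge_le {n m : ℕ} {p q : I} (hpq : p ≤ q) (j : Fin n)
    (w : Fin n → ℝ) :
    ∫ x, |∑ i : {i // i ≠ j}, w i * centredEdge m p q (pairEdge j i) (x (pairEdge j i))|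
      ∂edgeLaw n m p q ≤ √(q * ∑ i, w i ^ 2) := by
  set μ := edgeLaw n m p q
  let X : {i // i ≠ j} → (Edge n → Bool) → ℝ :=
    fun i x => w i * centredEdge m p q (pairEdge j i) (x (pairEdge j i))
  have hX0 : ∀ i, ∫ x, X i x ∂μ = 0 := fun i => by
    simp only [X, integral_const_mul, μ, integral_centredEdge, mul_zero]
  have hind : iIndepFun X μ := by
    have h1 : iIndepFun (fun (e : Edge n) (x : Edge n → Bool) => x e) μ :=
      iIndepFun_pi (X := fun _ b => b) fun e => aemeasurable_id
    exact (h1.precomp (pairEdge_injective j)).comp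
      (fun i b => w i * centredEdge m p q (pairEdge j i) b) fun i => measurable_of_finite _
  have hvar : Var[∑ i, X i; μ] ≤ q * ∑ i, w i ^ 2 := by
    rw [IndepFun.variance_sum (fun i _ => memLp_of_finite _)
      fun a _ b _ hab => hind.indepFun hab]
    calc ∑ i, Var[X i; μ] ≤ ∑ i : {i // i ≠ j}, (q : ℝ) * w i ^ 2 := by
          gcongr with i
          refine (variance_le_expectation_sq Integrable.of_finite.aestronglyMeasurable).trans ?_
          simp only [X, Pi.pow_apply, mul_pow, integral_const_mul]
          rw [mul_comm (q : ℝ)]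
          exact mul_le_mul_of_nonneg_left (integral_centredEdge_sq_le hpq _) (sq_nonneg _)
      _ ≤ ∑ i, (q : ℝ) * w i ^ 2 := by
          rw [Fintype.sum_eq_add_sum_subtype_ne (fun i => (q : ℝ) * w i ^ 2) j]
          exact le_add_of_nonneg_left (mul_nonneg q.2.1 (sq_nonneg _))
      _ = _ := by rw [Finset.mul_sum]
  have hs : ∀ x, ∑ i : {i // i ≠ j}, w i * centredEdge m p q (pairEdge j i) (x (pairEdge j i))
      = (∑ i, X i) x := fun x => by simp [X]
  simp only [hs]
  refine (integral_abs_le_sqrt (memLp_of_finite _)).trans (Real.sqrt_le_sqrt ?_)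
  rw [variance_of_integral_eq_zero Integrable.of_finite.aestronglyMeasurable.aemeasurable] at hvar
  · exact hvar
  · simp only [Finset.sum_apply]
    rw [integral_finsetSum _ fun i _ => Integrable.of_finite]
    simp [hX0]

open scoped Classical in
lemma adjMatrix_graphOfEdges_sub_meanAdj {n m : ℕ} {p q : I} (x : Edge n → Bool) (j : Fin n)
    (i : {i // i ≠ j}) :
    (graphOfEdges x).adjMatrix ℝ i j - meanAdj n m p q i j =
      centredEdge m p q (pairEdge j i) (x (pairEdge j i)) := by
  have h1 : (graphOfEdges x).Adj i j ↔ x (pairEdge j i) = true := by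
    have := i.2
    simp [graphOfEdges, pairEdge, this]
  have h2 : (edgeProb m p q (pairEdge j i) : ℝ) = meanAdj n m p q i j := by
    simp only [edgeProb, pairEdge, meanAdj, Sym2.mem_iff, forall_eq_or_imp, forall_eq,
      Matrix.of_apply]
    split_ifs <;> rfl
  rw [SimpleGraph.adjMatrix_apply, centredEdge, h2]
  simp only [h1]

lemma meanAdj_nonneg {n m : ℕ} (p q : I) (i j : Fin n) : 0 ≤ meanAdj n m p q i j := by
  simp only [meanAdj, Matrix.of_apply]
  split_ifs
  exacts [q.2.1, p.2.1]

lemma meanAdj_le {n m : ℕ} {p q : I} (hpq : p ≤ q) (i j : Fin n) : meanAdj n m p q i j ≤ q := by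
  simp only [meanAdj, Matrix.of_apply]
  split_ifs
  exacts [le_rfl, hpq]

lemma le_meanAdj {n m : ℕ} {p q : I} (hpq : p ≤ q) (i j : Fin n) : p ≤ meanAdj n m p q i j := by
  simp only [meanAdj, Matrix.of_apply]
  split_ifs
  exacts [hpq, le_rfl]

lemma mul_le_sum_meanAdj {n m : ℕ} {p q : I} (hpq : p ≤ q) (i : Fin n) :
    n * (p : ℝ) ≤ ∑ j, meanAdj n m p q i j := by
  have := Finset.sum_le_sum fun j (_ : j ∈ Finset.univ) => le_meanAdj (m := m) hpq i j
  simpa using this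

open scoped Classical in
/-- A weighted degree of the planted graph deviates in mean from its mean-field version by at most
its standard deviation, plus a term from the diagonal, where the mean-field matrix does not
vanish. -/
lemma integral_abs_sum_adjMatrix_sub_le {n m : ℕ} {p q : I} (hpq : p ≤ q) (j : Fin n)
    (w : Fin n → ℝ) :
    ∫ x, |∑ i, w i * ((graphOfEdges x).adjMatrix ℝ i j - meanAdj n m p q i j)|
      ∂edgeLaw n m p q ≤ √(q * ∑ i, w i ^ 2) + |w j| * q := by
  have h : ∀ x : Edge n → Bool,
      |∑ i, w i * ((graphOfEdges x).adjMatrix ℝ i j - meanAdj n m p q i j)| ≤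
      |∑ i : {i // i ≠ j}, w i * centredEdge m p q (pairEdge j i) (x (pairEdge j i))| +
        |w j| * q := by
    intro x
    rw [Fintype.sum_eq_add_sum_subtype_ne _ j, add_comm]
    simp only [adjMatrix_graphOfEdges_sub_meanAdj]
    refine (abs_add_le _ _).trans (add_le_add_right ?_ _)
    rw [abs_mul]
    refine mul_le_mul_of_nonneg_left ?_ (abs_nonneg _)
    simpa [abs_of_nonneg (meanAdj_nonneg p q j j)] using meanAdj_le hpq j j
  refine (integral_mono Integrable.of_finite Integrable.of_finite h).trans ?_
  rw [integral_add Integrable.of_finite Integrable.of_finite, integral_const]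
  simp only [probReal_univ, one_smul]
  exact add_le_add_left (integral_abs_sum_centredEdge_le hpq j w) _

/-! ### Personalized PageRank of the planted graph -/

/-- The mean `ℓ¹` distance between the Personalized PageRank of the planted graph and its
mean-field version. -/
lemma integral_sum_abs_ppr_sub_meanPPR_le {n m k : ℕ} {p q : I} (hn : 0 < n) (hk : k ≤ n)
    (hp : 0 < p) (hpq : p ≤ q) {α : ℝ} (hα₀ : 0 ≤ α) (hα₁ : α < 1) :
    ∫ G, ∑ i, |ppr α k G i - meanPPR n m k α p q i| ∂plantedGraph n m p q ≤
      α / (1 - α) * ((√(q * n) + q) / (n * p) +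
        (√(q * (1 / (k : ℝ) + q / (n * p))) / p + q / (n * p))) := by
  classical
  have hn' : (0 : ℝ) < n := Nat.cast_pos.2 hn
  have hp' : (0 : ℝ) < p := hp
  have hnp : 0 < n * (p : ℝ) := mul_pos hn' hp'
  have hq0 : (0 : ℝ) ≤ q := q.2.1
  set W' := meanAdj n m p q with hW'_def
  set v := meanPPR n m k α p q
  have hW' : ∀ i j, 0 ≤ W' i j := meanAdj_nonneg p q
  have hd : ∀ i, n * (p : ℝ) ≤ ∑ j, W' i j := mul_le_sum_meanAdj hpq
  have hd0 : ∀ i, 0 < ∑ j, W' i j := fun i => hnp.trans_le (hd i)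
  have hv1 : ∑ i, |v i| ≤ 1 := sum_abs_pprOfWeights_le_one hW' hα₀ hα₁ hk
  have hvM : ∀ i, |v i| ≤ 1 / (k : ℝ) + q / (n * p) := by
    refine abs_pprOfWeights_le hW' hα₀ hα₁ hk (div_nonneg hq0 hnp.le) fun i j => ?_
    rw [transitionMatrix_apply, abs_of_nonneg (mul_nonneg (inv_nonneg.2 (hd0 i).le) (hW' i j)),
      inv_mul_eq_div]
    exact div_le_div₀ hq0 (meanAdj_le hpq i j) hnp (hd i)
  set M : ℝ := 1 / (k : ℝ) + q / (n * p)
  have hM : 0 ≤ M := by positivity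
  have hvd : ∀ i, |v i / ∑ l, W' i l| ≤ |v i| / (n * p) := fun i => by
    rw [abs_div, abs_of_pos (hd0 i)]
    exact div_le_div_of_nonneg_left (abs_nonneg _) hnp (hd i)
  have hvd1 : ∑ i, |v i| / (n * (p : ℝ)) ≤ 1 / (n * p) := by
    rw [← Finset.sum_div]
    gcongr
  have hsq : ∑ i, (v i / ∑ l, W' i l) ^ 2 ≤ M / (n * p) ^ 2 := by
    calc ∑ i, (v i / ∑ l, W' i l) ^ 2 ≤ ∑ i, |v i| * M / (n * p) ^ 2 := by
          gcongr with i
          rw [← sq_abs]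
          refine (pow_le_pow_left₀ (abs_nonneg _) (hvd i) 2).trans ?_
          rw [div_pow, sq |v i|]
          have := hvM i
          gcongr
      _ ≤ M / (n * p) ^ 2 := by
          rw [← Finset.sum_div, ← Finset.sum_mul]
          gcongr
          exact mul_le_of_le_one_left hM hv1
  rw [plantedGraph, integral_map measurable_graphOfEdges.aemeasurable
    (Integrable.of_finite).aestronglyMeasurable]
  have hdet : ∀ x : Edge n → Bool, ∑ i, |ppr α k (graphOfEdges x) i - v i| ≤ α / (1 - α) *
      (∑ i, |v i| / (∑ l, W' i l) * |∑ l, (1 : ℝ) * ((graphOfEdges x).adjMatrix ℝ l i - W' l i)| +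
        ∑ j, |∑ i, v i / (∑ l, W' i l) * ((graphOfEdges x).adjMatrix ℝ i j - W' i j)|) := by
    intro x
    have hA : ∀ i j, 0 ≤ (graphOfEdges x).adjMatrix ℝ i j := fun i j => by
      rw [SimpleGraph.adjMatrix_apply]
      split_ifs <;> norm_num
    refine (sum_abs_pprOfWeights_sub_le hA hW' hα₀ hα₁ k).trans ?_
    refine mul_le_mul_of_nonneg_left ?_ (div_nonneg hα₀ (by linarith))
    refine (sum_abs_vecMul_transitionMatrix_sub_le hA hd0 v).trans_eq ?_
    have hsymm : ∀ i l, (graphOfEdges x).adjMatrix ℝ i l - W' i l =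
        1 * ((graphOfEdges x).adjMatrix ℝ l i - W' l i) := fun i l => by
      simp only [SimpleGraph.adjMatrix_apply, SimpleGraph.adj_comm, hW'_def, meanAdj,
        Matrix.of_apply, and_comm, one_mul]
    exact congrArg (· + _) (Finset.sum_congr rfl fun i _ => by
      rw [Finset.sum_congr rfl fun l _ => hsymm i l])
  refine (integral_mono Integrable.of_finite Integrable.of_finite hdet).trans ?_
  rw [integral_const_mul]
  refine mul_le_mul_of_nonneg_left ?_ (div_nonneg hα₀ (by linarith))
  rw [integral_add Integrable.of_finite Integrable.of_finite,
    integral_finsetSum _ fun i _ => Integrable.of_finite,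
    integral_finsetSum _ fun i _ => Integrable.of_finite]
  refine add_le_add ?_ ?_
  · calc _ ≤ ∑ i, |v i| / (n * (p : ℝ)) * (√(q * n) + q) := by
          gcongr with i
          rw [integral_const_mul]
          have := integral_abs_sum_adjMatrix_sub_le (m := m) hpq i (fun _ => 1)
          simp only [one_pow, abs_one, one_mul, Finset.sum_const, Finset.card_univ,
            Fintype.card_fin, nsmul_eq_mul, mul_one] at this
          simp only [one_mul]
          have h0 := hd0 i
          gcongr
          exact hd i
      _ ≤ 1 / (n * p) * (√(q * n) + q) := by
          rw [← Finset.sum_mul]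
          gcongr
      _ = _ := by ring
  · calc _ ≤ ∑ j, (√(q * (M / (n * p) ^ 2)) + |v j| / (n * p) * q) := by
          gcongr with j
          refine (integral_abs_sum_adjMatrix_sub_le hpq j _).trans ?_
          gcongr
          exact hvd j
      _ = n * √(q * (M / (n * p) ^ 2)) + (∑ j, |v j| / (n * (p : ℝ))) * q := by
          rw [Finset.sum_add_distrib, Finset.sum_mul]
          simp
      _ ≤ n * √(q * (M / (n * p) ^ 2)) + 1 / (n * p) * q := by gcongr
      _ = _ := by
          rw [← mul_div_assoc, Real.sqrt_div (mul_nonneg hq0 hM), Real.sqrt_sq hnp.le]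
          field_simp

/-- Markov's inequality for a uniformly random coordinate. -/
lemma measureReal_prod_uniformOn_le {Ω : Type*} [MeasurableSpace Ω] [MeasurableSingletonClass Ω]
    [Finite Ω] (μ : Measure Ω) [IsProbabilityMeasure μ] {n : ℕ} (f : Ω → Fin n → ℝ) {ε : ℝ}
    (hε : 0 < ε) :
    (μ.prod (uniformOn Set.univ)).real {x | ε * (n : ℝ)⁻¹ ≤ |f x.1 x.2|} ≤
      (∫ ω, ∑ i, |f ω i| ∂μ) / ε := by
  rcases Nat.eq_zero_or_pos n with rfl | hn
  · have : {x : Ω × Fin 0 | ε * ((0 : ℕ) : ℝ)⁻¹ ≤ |f x.1 x.2|} = ∅ := by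
      ext x
      exact x.2.elim0
    rw [this, measureReal_empty]
    exact div_nonneg (integral_nonneg fun ω => by simp) hε.le
  have : NeZero n := ⟨hn.ne'⟩
  have hn' : (0 : ℝ) < n := Nat.cast_pos.2 hn
  have hu : ∀ g : Fin n → ℝ, ∫ i, g i ∂(uniformOn Set.univ) = (n : ℝ)⁻¹ * ∑ i, g i := by
    intro g
    rw [integral_fintype Integrable.of_finite, Finset.mul_sum]
    refine Finset.sum_congr rfl fun i _ => ?_
    simp [measureReal_def, uniformOn_univ]
  have h := mul_meas_ge_le_integral_of_nonneg (μ := μ.prod (uniformOn Set.univ))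
    (f := fun x : Ω × Fin n => |f x.1 x.2|) (ae_of_all _ fun x => abs_nonneg _)
    Integrable.of_finite (ε * (n : ℝ)⁻¹)
  rw [integral_prod _ Integrable.of_finite] at h
  simp only [hu, integral_const_mul] at h
  rw [le_div_iff₀ hε]
  refine le_of_mul_le_mul_left ?_ (inv_pos.2 hn')
  linarith

end PlantedPPR

theorem theorem2
    (α : ℝ) (hα₀ : 0 < α) (hα₁ : α < 1)
    (k m : ℕ → ℕ) (p q : ℕ → I)
    (hkm : ∀ n, k n ≤ m n) (hmn : ∀ n, m n ≤ n) (hpq : ∀ n, p n < q n)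
    (hnq : (fun n : ℕ => Real.log (n : ℝ)) =o[atTop] fun n : ℕ => (n : ℝ) * (q n : ℝ))
    (hratio : (fun n : ℕ => (p n : ℝ) / (q n : ℝ)) =Θ[atTop] fun _ : ℕ => (1 : ℝ))
    (hkp : (fun n : ℕ => Real.log (n : ℝ)) =o[atTop] fun n : ℕ => (k n : ℝ) * (p n : ℝ)) :
    ∀ ε : ℝ, 0 < ε →
      Tendsto (fun n : ℕ => (PlantedPPR.plantedGraphWithNode n (m n) (p n) (q n)).real
          {x | ε * (n : ℝ)⁻¹ ≤ |PlantedPPR.ppr α (k n) x.1 x.2 -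
            PlantedPPR.meanClassValue n (m n) (k n) α (p n) (q n)
              (PlantedPPR.nodeClass (m n) (k n) x.2)|})
        atTop (𝓝 0) := by
  intro ε hε
  have hlog : Tendsto (fun n : ℕ => Real.log (n : ℝ)) atTop atTop :=
    Real.tendsto_log_atTop.comp tendsto_natCast_atTop_atTop
  have hkp_top : Tendsto (fun n : ℕ => (k n : ℝ) * (p n : ℝ)) atTop atTop := by
    have h1 : (fun _ : ℕ => (1 : ℝ)) =o[atTop] fun n : ℕ => (k n : ℝ) * (p n : ℝ) :=
      ((isLittleO_const_left.2 (Or.inr (tendsto_norm_atTop_atTop.comp hlog)))).trans hkp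
    refine ((isLittleO_const_left.1 h1).resolve_left one_ne_zero).congr fun n => ?_
    exact Real.norm_of_nonneg (mul_nonneg (Nat.cast_nonneg _) (p n).2.1)
  -- `C` bounds the ratio `q / p`.
  obtain ⟨C, hC0, hC⟩ := hratio.isBigO_symm.exists_pos
  have hs : Tendsto (fun n : ℕ => ((k n : ℝ) * (p n : ℝ))⁻¹) atTop (𝓝 0) :=
    hkp_top.inv_tendsto_atTop
  have hlim : Tendsto (fun n : ℕ => α / (1 - α) *
      ((√(C * ((k n : ℝ) * (p n : ℝ))⁻¹) + ((k n : ℝ) * (p n : ℝ))⁻¹) +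
      (√((C + C * C) * ((k n : ℝ) * (p n : ℝ))⁻¹) + ((k n : ℝ) * (p n : ℝ))⁻¹)) / ε)
      atTop (𝓝 0) := by
    have h : ∀ c : ℝ, Tendsto (fun n : ℕ => √(c * ((k n : ℝ) * (p n : ℝ))⁻¹)) atTop (𝓝 0) := by
      intro c
      simpa using (hs.const_mul c).sqrt
    simpa using (((((h C).add hs).add ((h (C + C * C)).add hs)).const_mul (α / (1 - α))).div_const ε)
  refine tendsto_of_tendsto_of_tendsto_of_le_of_le' tendsto_const_nhds hlim
    (Eventually.of_forall fun n => measureReal_nonneg) ?_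
  filter_upwards [hC.bound, hkp_top.eventually_gt_atTop 0, eventually_gt_atTop 0]
    with n hCn hkpn hn
  have hp : (0 : ℝ) < p n := pos_of_mul_pos_right hkpn (Nat.cast_nonneg _)
  have hk : (0 : ℝ) < k n := pos_of_mul_pos_left hkpn hp.le
  have hq : (0 : ℝ) < q n := hp.trans (hpq n)
  have hq1 : (q n : ℝ) ≤ 1 := (q n).2.2
  have hn' : (0 : ℝ) < n := Nat.cast_pos.2 hn
  have hkn : (k n : ℝ) ≤ n := Nat.cast_le.2 ((hkm n).trans (hmn n))
  have hqC : (q n : ℝ) ≤ C * p n := by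
    rw [norm_one, Real.norm_of_nonneg (by positivity), ← mul_div_assoc, le_div_iff₀ hq,
      one_mul] at hCn
    exact hCn
  simp only [← PlantedPPR.meanPPR_eq_meanClassValue (hkm n)]
  refine (PlantedPPR.measureReal_prod_uniformOn_le _ (fun G i => PlantedPPR.ppr α (k n) G i -
    PlantedPPR.meanPPR n (m n) (k n) α (p n) (q n) i) hε).trans ?_
  gcongr
  refine (PlantedPPR.integral_sum_abs_ppr_sub_meanPPR_le hn ((hkm n).trans (hmn n)) hp
    (hpq n).le hα₀.le hα₁).trans ?_
  refine mul_le_mul_of_nonneg_left ?_ (div_nonneg hα₀.le (by linarith))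
  generalize (p n : ℝ) = p at *
  generalize (q n : ℝ) = q at *
  generalize (k n : ℝ) = k at *
  generalize (n : ℝ) = n at *
  have hnk : (n * p)⁻¹ ≤ (k * p)⁻¹ := by gcongr
  have h1 : q / (n * p) ≤ (k * p)⁻¹ := by
    rw [div_eq_mul_inv]
    exact (mul_le_of_le_one_left (by positivity) hq1).trans hnk
  have hr : q / p ≤ C := (div_le_iff₀ hp).2 hqC
  refine add_le_add ?_ (add_le_add ?_ h1)
  · rw [add_div]
    refine add_le_add ?_ h1
    rw [div_le_iff₀ (by positivity)]
    refine Real.sqrt_le_iff.2 ⟨by positivity, ?_⟩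
    rw [mul_pow, Real.sq_sqrt (by positivity)]
    calc q * n = (q / p) * (n * p)⁻¹ * (n * p) ^ 2 := by field_simp
      _ ≤ _ := by gcongr
  · rw [div_le_iff₀ hp]
    refine Real.sqrt_le_iff.2 ⟨by positivity, ?_⟩
    rw [mul_pow, Real.sq_sqrt (by positivity)]
    calc q * (1 / k + q / (n * p))
        = ((q / p) * (k * p)⁻¹ + (q / p) * (q / p) * (n * p)⁻¹) * p ^ 2 := by field_simp
      _ ≤ (C * (k * p)⁻¹ + C * C * (k * p)⁻¹) * p ^ 2 := by gcongr
      _ = _ := by ring
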